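/- **Setting.** Let $E$ be a random outcome and $A_1,\dots,A_m$ base signals, all with finitely many values, with joint prior $P$. For $O\subseteq\{1,\dots,m\}$ let $A_O$ be the signal that reveals $A_s$ for all $s\in O$. A *garbling* of $A_O$ is a signal that is a (measurable) function of $A_O$ and of a uniform random seed in $[0,1]$ independent of $(A_1,\dots,A_m,E)$; these are the signals $A'\preceq A_O$ of the continuous signal lattice. Write $A\vee B$ for the signal that reveals both $A$ and $B$. Let $S:\Delta_E\times E\to\mathbb R$ be a (measurable) strictly proper scoring rule: for every belief $q\in\Delta_E$, the expected score $\sum_e q(e)S(r,e)$ is maximized over $r\in\Delta_E$ only by $r=q$. The value of a signal $A$ is $V(A)=\mathbb E_{a}\big[\max_{r\in\Delta_E}\mathbb E[S(r,E)\mid A=a]\big]$. The signals are *strict, strong substitutes* with respect to $S$ if for all $O,Q\subseteq\{1,\dots,m\}$ and every garbling $A'$ of $A_O$, $$V(A'\vee A_Q)-V(A')\ \ge\ V(A_O\vee A_Q)-V(A_O),$$ with strict inequality whenever neither of $O,Q$ contains the other and $A'$ is strictly less informative than $A_O$ (i.e. $A'$ does not almost surely determine $A_O$). **Market.** There are finitely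 many traders; trader $j$ privately observes $A_{O_j}$ for some $O_j\subseteq\{1,\dots,m\}$. The initial prediction $p^{(0)}$ is the prior distribution of $E$. At each step $t=1,\dots,T$ a designated trader $i_t$ sees all predictions so far and moves the current prediction $p^{(t-1)}\in\Delta_E$ to any $p^{(t)}\in\Delta_E$. Trader $j$'s payoff is $\sum_{t:\,i_t=j}\big(S(p^{(t)},E)-S(p^{(t-1)},E)\big)$. A strategy specifies a report at each of the trader's steps as a (measurable) function of her signal, the past predictions, and a private uniform seed independent of everything else. A profile is a Bayes–Nash equilibrium if the scores $S(p^{(t)},E)$, $0\le t\le T$, have finite expectation and no trader can raise her ex ante expected payoff by changing her own strategy (to one under which her payoff has finite expectation). Trader $i_t$ *reports truthfully* at $t$ if, almost surely, $p^{(t)}$ is the conditional distribution of $E$ given her signal and $p^{(0)},\dots,p^{(t-1)}$. Number the traders who get to trade $1,2,\dots,k$ in order of their first trading opportunity. A profile is *all-rush* if each trader $i<k$ reports truthfully at some step before trader $i+1$'s first trading opportunity, and trader $k$ reports truthfully at some step $t\le T$. **Theorem.** Suppose the signals are strict, strong substitutes with respect to $S$. Then for every set of traders and every trading order such that each trader $i\ge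 2$ observes at least one base signal not observed by any of the traders $1,\dots,i-1$ (that is, $O_i\not\subseteq O_1\cup\dots\cup O_{i-1}$), every Bayes–Nash equilibrium is all-rush. -/

import Mathlib

open MeasureTheory

noncomputable section

/-! ### Predictions and scoring rules -/

/-- A prediction: a probability distribution on the finite set of outcomes `E`. -/
abbrev Prediction (E : Type*) [Fintype E] : Type _ := ↥(stdSimplex ℝ E)

/-- `S r e` is the score of the prediction `r` when the outcome is `e`. The rule is strictly proper
if the expected score under any belief `q` is uniquely maximized by reporting `q`. -/
def StrictlyProper {E : Type*} [Fintype E] (S : Prediction E → E → ℝ) : Prop :=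
  ∀ q r : Prediction E, r ≠ q → ∑ e, q.1 e * S r e < ∑ e, q.1 e * S q e

/-! ### Posteriors and the value of information

A signal on a probability space `Ω` is represented by the σ-algebra of events that it reveals (the
measurable form of an information partition): `m' ≤ m` says that `m'` is coarser than `m`, and
`m ⊔ m'` is the signal of an agent who observes both. -/

/-- The posterior probability of the outcome `e` given the signal `m`. -/
def posterior {Ω E : Type*} {mΩ : MeasurableSpace Ω} (μ : Measure Ω) (out : Ω → E)
    (m : MeasurableSpace Ω) (e : E) : Ω → ℝ :=
  μ[Set.indicator (out ⁻¹' {e}) (fun _ => (1 : ℝ)) | m]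

/-- The value of the signal `m` in the decision problem with decision space `D` and utility `u`:
the expected utility of an agent who observes `m` and then takes an optimal decision. -/
def signalValue {Ω E D : Type*} {mΩ : MeasurableSpace Ω} [Fintype E] (μ : Measure Ω)
    (out : Ω → E) (u : D → E → ℝ) (m : MeasurableSpace Ω) : ℝ :=
  ∫ ω, ⨆ d : D, ∑ e, posterior μ out m e ω * u d e ∂μ

/-- The signal `m'` almost surely reveals the signal `m`: up to null sets, every event of `m` is
an event of `m'`. -/
def Reveals {Ω : Type*} {mΩ : MeasurableSpace Ω} (μ : Measure Ω) (m' m : MeasurableSpace Ω) : Prop :=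
  ∀ X : Set Ω, MeasurableSet[m] X → ∃ Y : Set Ω, MeasurableSet[m'] Y ∧ X =ᵐ[μ] Y

/-! ### Strong substitutes

The base signals are indexed by `I`; the base signal `s` takes values in `A s`. The prior is a
probability measure on `(∀ s, A s) × E`. Randomized functions of signals are modelled as
deterministic functions of the signal and of a uniform seed in `[0,1]` that is independent of all
base signals and of the outcome. -/

section Substitutes

variable {I : Type*} {A : I → Type*} {E : Type*}
  [∀ s, MeasurableSpace (A s)] [MeasurableSpace E]

/-- The prior together with an independent uniform seed. -/
def seededPrior (P : Measure ((∀ s, A s) × E)) :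
    Measure (((∀ s, A s) × E) × unitInterval) :=
  P.prod volume

/-- The subsets-lattice signal `A_S`: observe the realizations of the base signals in `S`. -/
abbrev subsetSignal (S : Finset I) : MeasurableSpace (((∀ s, A s) × E) × unitInterval) :=
  MeasurableSpace.comap (fun ω (s : S) => ω.1.1 s) inferInstance

/-- The signal `A_S` together with the random seed. The signals of the continuous lattice that lie
below `A_S` (the garblings of `A_S`) are those coarser than this one. -/
abbrev seededSubsetSignal (S : Finset I) : MeasurableSpace (((∀ s, A s) × E) × unitInterval) :=
  MeasurableSpace.comap (fun ω => ((fun (s : S) => ω.1.1 s), ω.2)) inferInstance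

/-- Strict, strong substitutes for the decision problem `u`: for `A_S`, `A_T` on the subsets lattice
and a garbling `m` of `A_S`, the marginal value of `A_T` over `m` is at least its marginal value
over `A_S`; and it is strictly larger whenever `A_S` and `A_T` are incomparable and `m` is strictly
less informative than `A_S`, that is, does not almost surely reveal `A_S`. -/
def StrictStrongSubstitutes [Fintype E] {D : Type*} (P : Measure ((∀ s, A s) × E))
    (u : D → E → ℝ) : Prop :=
  let V : MeasurableSpace (((∀ s, A s) × E) × unitInterval) → ℝ :=
    signalValue (seededPrior P) (fun ω => ω.1.2) u
  ∀ (S T : Finset I) (m : MeasurableSpace (((∀ s, A s) × E) × unitInterval)),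
    m ≤ seededSubsetSignal S →
      V (subsetSignal S ⊔ subsetSignal T) - V (subsetSignal S) ≤ V (m ⊔ subsetSignal T) - V m ∧
      (¬ S ⊆ T → ¬ T ⊆ S → ¬ Reveals (seededPrior P) m (subsetSignal S) →
        V (subsetSignal S ⊔ subsetSignal T) - V (subsetSignal S) < V (m ⊔ subsetSignal T) - V m)

end Substitutes

/-! ### The market

The traders are the elements of `J`; trader `j` observes the base signals in `obs j`. There are `N`
trading steps, numbered `0, …, N - 1`; at step `t` trader `order t` moves the market prediction from
`p⁽ᵗ⁾` to `p⁽ᵗ⁺¹⁾` (values of `order` at `N` and beyond play no role). Randomization is by private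
seeds: trader `j` has a uniform seed in `[0,1]`, independent of everything else. -/

/-- A (randomized) strategy of a trader who observes the base signals in `O`: for each step `t`,
a report as a function of her signal, her seed and the predictions `p⁽⁰⁾, …, p⁽ᵗ⁾` so far. -/
structure Strategy {I : Type*} (A : I → Type*) (E : Type*) [∀ s, MeasurableSpace (A s)]
    [Fintype E] (O : Finset I) where
  act : (t : ℕ) → ((s : O) → A s) → unitInterval → (Fin (t + 1) → Prediction E) → Prediction E
  measurable_act : ∀ t, Measurable
    (fun x : ((s : O) → A s) × unitInterval × (Fin (t + 1) → Prediction E) =>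
      act t x.1 x.2.1 x.2.2)

section Market

variable {I : Type*} {A : I → Type*} {E : Type*} {J : Type*}
  [∀ s, MeasurableSpace (A s)] [Fintype E] [MeasurableSpace E]

/-- The prior distribution of the outcome, which is the initial market prediction. -/
def priorPrediction [MeasurableSingletonClass E] (P : Measure ((∀ s, A s) × E))
    [IsProbabilityMeasure P] : Prediction E :=
  ⟨fun e => P.real (Prod.snd ⁻¹' {e}), fun _ => measureReal_nonneg, by
    rw [sum_measureReal_preimage_singleton Finset.univ
      (fun y _ => measurable_snd (measurableSet_singleton y))]
    simp⟩

/-- The joint law of the base signals, the outcome and the traders' private seeds. -/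
def marketMeasure [Fintype J] (P : Measure ((∀ s, A s) × E)) :
    Measure (((∀ s, A s) × E) × (J → unitInterval)) :=
  P.prod (Measure.pi fun _ => volume)

/-- The sequence of predictions `p⁽⁰⁾, …, p⁽ᵗ⁾` when the market starts at `p₀` and the
strategy profile `σ` is played. -/
def history (p₀ : Prediction E) {obs : J → Finset I} (order : ℕ → J)
    (σ : (j : J) → Strategy A E (obs j)) :
    (t : ℕ) → ((∀ s, A s) × E) × (J → unitInterval) → (Fin (t + 1) → Prediction E)
  | 0, _ => fun _ => p₀
  | t + 1, ω =>
      Fin.snoc (α := fun _ => Prediction E) (history p₀ order σ t ω)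
        ((σ (order t)).act t (fun s => ω.1.1 s) (ω.2 (order t)) (history p₀ order σ t ω))

/-- The market prediction `p⁽ᵗ⁾`. -/
def price (p₀ : Prediction E) {obs : J → Finset I} (order : ℕ → J)
    (σ : (j : J) → Strategy A E (obs j)) (t : ℕ)
    (ω : ((∀ s, A s) × E) × (J → unitInterval)) : Prediction E :=
  history p₀ order σ t ω (Fin.last t)

/-- Trader `j`'s payoff: the sum of `S(p⁽ᵗ⁺¹⁾, e) - S(p⁽ᵗ⁾, e)` over the steps `t` at which
she trades. -/
def payoff [DecidableEq J] (S : Prediction E → E → ℝ) (p₀ : Prediction E) {obs : J → Finset I}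
    (order : ℕ → J) (N : ℕ) (σ : (j : J) → Strategy A E (obs j)) (j : J)
    (ω : ((∀ s, A s) × E) × (J → unitInterval)) : ℝ :=
  ∑ t ∈ (Finset.range N).filter (fun t => order t = j),
    (S (price p₀ order σ (t + 1) ω) ω.1.2 - S (price p₀ order σ t ω) ω.1.2)

/-- Bayes–Nash equilibrium: the scores on the path of play have finite expectation (automatic if
`S` is bounded), and no trader can raise her expected payoff by a unilateral change of strategy
under which her payoff has a finite expectation. -/
def IsBayesNash [MeasurableSingletonClass E] [Fintype J] [DecidableEq J]
    (P : Measure ((∀ s, A s) × E)) [IsProbabilityMeasure P] (S : Prediction E → E → ℝ)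
    {obs : J → Finset I} (order : ℕ → J) (N : ℕ) (σ : (j : J) → Strategy A E (obs j)) : Prop :=
  (∀ t ≤ N, Integrable (fun ω => S (price (priorPrediction P) order σ t ω) ω.1.2)
    (marketMeasure P)) ∧
  ∀ (j : J) (τ : Strategy A E (obs j)),
    Integrable (payoff S (priorPrediction P) order N (Function.update σ j τ) j)
      (marketMeasure P) →
    ∫ ω, payoff S (priorPrediction P) order N (Function.update σ j τ) j ω ∂(marketMeasure P) ≤
      ∫ ω, payoff S (priorPrediction P) order N σ j ω ∂(marketMeasure P)

/-- The information of the trader who trades at step `t`: her signal and the predictions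
`p⁽⁰⁾, …, p⁽ᵗ⁾`. -/
abbrev traderInfo (p₀ : Prediction E) {obs : J → Finset I} (order : ℕ → J)
    (σ : (j : J) → Strategy A E (obs j)) (t : ℕ) :
    MeasurableSpace (((∀ s, A s) × E) × (J → unitInterval)) :=
  MeasurableSpace.comap
    (fun ω => ((fun (s : obs (order t)) => ω.1.1 s), history p₀ order σ t ω)) inferInstance

/-- The trader who trades at step `t` reports truthfully: almost surely she moves the market
prediction to her current posterior distribution on the outcome. -/
def TruthfulAt [MeasurableSingletonClass E] [Fintype J] (P : Measure ((∀ s, A s) × E))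
    [IsProbabilityMeasure P] {obs : J → Finset I} (order : ℕ → J)
    (σ : (j : J) → Strategy A E (obs j)) (t : ℕ) : Prop :=
  ∀ e, (fun ω => (price (priorPrediction P) order σ (t + 1) ω).1 e) =ᵐ[marketMeasure P]
    posterior (marketMeasure P) (fun ω => ω.1.2)
      (traderInfo (priorPrediction P) order σ t) e

/-- Step `t` is the first trading opportunity of trader `j`. -/
def FirstTrade (order : ℕ → J) (N : ℕ) (j : J) (t : ℕ) : Prop :=
  t < N ∧ order t = j ∧ ∀ t' < t, order t' ≠ j

/-- All-rush: every trader who gets to trade reports truthfully at some step before the first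
trading opportunity of the trader who arrives next (hence of all who arrive after her), the last
trader to arrive doing so before the market closes. -/
def AllRush [MeasurableSingletonClass E] [Fintype J] (P : Measure ((∀ s, A s) × E))
    [IsProbabilityMeasure P] {obs : J → Finset I} (order : ℕ → J) (N : ℕ)
    (σ : (j : J) → Strategy A E (obs j)) : Prop :=
  ∀ (j : J) (t₀ : ℕ), FirstTrade order N j t₀ →
    ∃ t < N, order t = j ∧ TruthfulAt P order σ t ∧
      ∀ (k : J) (t₁ : ℕ), FirstTrade order N k t₁ → t₀ < t₁ → t < t₁

/-- Every trader other than the first to arrive observes at least one base signal that is not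
observed by any trader who arrived before her. -/
def ArrivalsInformative (obs : J → Finset I) (order : ℕ → J) (N : ℕ) : Prop :=
  ∀ (j : J) (t : ℕ), FirstTrade order N j t → 0 < t →
    ∃ s ∈ obs j, ∀ t' < t, s ∉ obs (order t')

end Market

end

noncomputable section

set_option linter.unusedSectionVars false

/-! ### Expected scores, posteriors and the value of a signal. -/

section SignalValue

variable {Ω E : Type*} {mΩ : MeasurableSpace Ω} {μ : Measure Ω}

/-! The proof is payoff accounting along the order of arrivals. Let `Q t` be the base signals
observed by those who traded before step `t`. A trader arriving at `t` can report her posterior and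
then pass, so her equilibrium payoff is at least the value of her signal joined with the history,
minus the current expected score, hence at least her marginal value over the history
(`IsBayesNash.integral_payoff_add_le`). The history is a garbling of the signal `Q t`, so by
substitutes this is at least her marginal value over `Q t`.

Summed over arrivals, these bounds telescope to the value of all information minus that of none.
Payoffs also telescope, to final minus initial expected score, which is no larger. So every
inequality is an equality. Strictness then forces the history, and even the current price, to be
worth as much as `Q t` at each arrival.

Hence at the next arrival (or the close) the traders so far have already earned everything they ever
will, since nobody gains by ceasing to trade. Consider a trader's last trade before that moment. Her
optimal deviation there shows that her report scores at least the value of her own information,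
which is at least the value of all signals observed so far. By strict propriety both her report and
her posterior are the posterior given those signals, so she is truthful. The inequalities are
isolated in `exists_optimal_report_of_accounting`.

Two technical matters remain. Scores may be unbounded below, so integrability of truthful scores
must be proved (`integrable_score_truthfulReport`). And the substitutes condition speaks of one seed
while the market has one per trader; `StrictStrongSubstitutes.market` bridges the two. -/

theorem lintegral_restrict_eq_lintegral_condExp_mul [IsFiniteMeasure μ] {B : Set Ω}
    (hB : MeasurableSet B)
    {m : MeasurableSpace Ω} (hm : m ≤ mΩ) {f : Ω → ENNReal} (hf : Measurable[m] f) :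
    ∫⁻ ω in B, f ω ∂μ =
      ∫⁻ ω, ENNReal.ofReal ((μ[B.indicator (fun _ => (1 : ℝ)) | m]) ω) * f ω ∂μ := by
  have hint : Integrable (B.indicator fun _ => (1 : ℝ)) μ := (integrable_const 1).indicator hB
  have hpos : 0 ≤ᵐ[μ] μ[B.indicator (fun _ => (1 : ℝ)) | m] :=
    condExp_nonneg (Filter.Eventually.of_forall fun ω => Set.indicator_nonneg (by simp) ω)
  have hmeas : Measurable[mΩ] fun ω => ENNReal.ofReal ((μ[B.indicator (fun _ => (1 : ℝ)) | m]) ω) :=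
    (stronglyMeasurable_condExp.mono hm).measurable.ennreal_ofReal
  -- On `m`, restriction to `B` and the density `P(B | m)` give the same measure. Working with
  -- measures avoids assuming `f` integrable.
  have key : (μ.restrict B).trim hm =
      (μ.withDensity fun ω => ENNReal.ofReal ((μ[B.indicator (fun _ => (1 : ℝ)) | m]) ω)).trim hm := by
    refine @Measure.ext _ m _ _ fun s hs => ?_
    rw [trim_measurableSet_eq hm hs, trim_measurableSet_eq hm hs, withDensity_apply _ (hm s hs),
      ← ofReal_integral_eq_lintegral_ofReal integrable_condExp.integrableOn
        (ae_restrict_of_ae hpos),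
      setIntegral_condExp hm hint hs, integral_indicator hB, Measure.restrict_apply (hm s hs),
      Measure.restrict_restrict hB]
    simp [Set.inter_comm]
  rw [← lintegral_trim hm hf, key, lintegral_trim hm hf,
    lintegral_withDensity_eq_lintegral_mul _ hmeas (hf.mono hm le_rfl)]
  rfl

/-- Converse to the usual pull-out property: here integrability is deduced from the conditional
side, where it is easy to check for truthful reports. -/
theorem integrable_indicator_of_integrable_condExp_mul [IsFiniteMeasure μ] {B : Set Ω}
    (hB : MeasurableSet B)
    {m : MeasurableSpace Ω} (hm : m ≤ mΩ) {f : Ω → ℝ} (hf : Measurable[m] f)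
    (h : Integrable (fun ω => (μ[B.indicator (fun _ => (1 : ℝ)) | m]) ω * f ω) μ) :
    Integrable (B.indicator f) μ := by
  refine (integrable_indicator_iff hB).2 ⟨(hf.mono hm le_rfl).aestronglyMeasurable, ?_⟩
  have hpos : 0 ≤ᵐ[μ] μ[B.indicator (fun _ => (1 : ℝ)) | m] :=
    condExp_nonneg (Filter.Eventually.of_forall fun ω => Set.indicator_nonneg (by simp) ω)
  have hf' : Measurable[m] fun ω => ‖f ω‖ₑ := measurable_enorm.comp hf
  rw [hasFiniteIntegral_iff_enorm, lintegral_restrict_eq_lintegral_condExp_mul hB hm hf']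
  refine lt_of_le_of_lt (lintegral_mono_ae ?_) h.2
  filter_upwards [hpos] with ω hω
  rw [enorm_mul, Real.enorm_eq_ofReal hω]

theorem integral_indicator_eq_integral_condExp_mul [IsFiniteMeasure μ] {B : Set Ω}
    (hB : MeasurableSet B)
    {m : MeasurableSpace Ω} (hm : m ≤ mΩ) {f : Ω → ℝ} (hf : Measurable[m] f)
    (h : Integrable (B.indicator f) μ) :
    Integrable (fun ω => (μ[B.indicator (fun _ => (1 : ℝ)) | m]) ω * f ω) μ ∧
    ∫ ω, B.indicator f ω ∂μ = ∫ ω, (μ[B.indicator (fun _ => (1 : ℝ)) | m]) ω * f ω ∂μ := by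
  have hint : Integrable (B.indicator fun _ => (1 : ℝ)) μ := (integrable_const 1).indicator hB
  have hmul : (B.indicator (fun _ => (1 : ℝ))) * f = B.indicator f := by
    ext ω
    by_cases hω : ω ∈ B <;> simp [hω]
  have := condExp_mul_of_stronglyMeasurable_right (m := m) (μ := μ)
    (f := B.indicator fun _ => (1 : ℝ)) (g := f) hf.stronglyMeasurable (by rwa [hmul]) hint
  rw [hmul] at this
  refine ⟨integrable_condExp.congr this, ?_⟩
  rw [← integral_condExp hm (f := B.indicator f)]
  exact integral_congr_ae this

variable [Fintype E] [MeasurableSpace E] [MeasurableSingletonClass E] {out : Ω → E}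

theorem posterior_mem_stdSimplex [IsProbabilityMeasure μ] (hout : Measurable out)
    {m : MeasurableSpace Ω} (hm : m ≤ mΩ) :
    ∀ᵐ ω ∂μ, (fun e => posterior μ out m e ω) ∈ stdSimplex ℝ E := by
  have h0 : ∀ᵐ ω ∂μ, ∀ e, 0 ≤ posterior μ out m e ω := by
    rw [ae_all_iff]
    exact fun e =>
      condExp_nonneg (Filter.Eventually.of_forall fun ω => Set.indicator_nonneg (by simp) ω)
  have h1 : ∀ᵐ ω ∂μ, ∑ e, posterior μ out m e ω = 1 := by
    have h2 := condExp_finsetSum (μ := μ) (s := Finset.univ)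
      (f := fun e => Set.indicator (out ⁻¹' {e}) (fun _ => (1 : ℝ)))
      (fun e _ => (integrable_const 1).indicator (hout (measurableSet_singleton e))) m
    have h3 : ∑ e, Set.indicator (out ⁻¹' {e}) (fun _ => (1 : ℝ)) = fun _ => (1 : ℝ) := by
      classical
      ext ω
      simp [Finset.sum_apply, Set.indicator_apply]
    rw [h3, condExp_const hm] at h2
    filter_upwards [h2] with ω hω
    rw [Finset.sum_apply] at hω
    exact hω.symm
  filter_upwards [h0, h1] with ω h0 h1 using ⟨h0, h1⟩

/-- The report of an agent who observes `m` and reports the posterior distribution of the outcome;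
`q₀` is used where the version of the posterior is not a probability distribution. -/
def truthfulReport (μ : Measure Ω) (out : Ω → E) (q₀ : Prediction E) (m : MeasurableSpace Ω)
    (ω : Ω) : Prediction E :=
  open Classical in
  ⟨if (fun e => posterior μ out m e ω) ∈ stdSimplex ℝ E then (fun e => posterior μ out m e ω)
    else q₀.1, by split_ifs with h; exacts [h, q₀.2]⟩

theorem measurable_truthfulReport (q₀ : Prediction E) (m : MeasurableSpace Ω) :
    Measurable[m] (truthfulReport μ out q₀ m) := by
  have h : Measurable[m] fun ω => fun e => posterior μ out m e ω :=
    @measurable_pi_lambda _ _ _ m _ _ fun e => stronglyMeasurable_condExp.measurable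
  refine @Measurable.subtype_mk _ _ m _ _ _ ?_ _
  exact Measurable.ite (h (isClosed_stdSimplex ℝ E).measurableSet) h measurable_const

theorem truthfulReport_ae_eq [IsProbabilityMeasure μ] (q₀ : Prediction E) (hout : Measurable out)
    {m : MeasurableSpace Ω} (hm : m ≤ mΩ) :
    ∀ᵐ ω ∂μ, ∀ e, (truthfulReport μ out q₀ m ω).1 e = posterior μ out m e ω := by
  filter_upwards [posterior_mem_stdSimplex (μ := μ) hout hm] with ω hω e
  simp [truthfulReport, hω]

variable {S : Prediction E → E → ℝ}

theorem StrictlyProper.le (hS : StrictlyProper S) (q r : Prediction E) :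
    ∑ e, q.1 e * S r e ≤ ∑ e, q.1 e * S q e := by
  by_cases h : r = q
  · rw [h]
  · exact (hS q r h).le

theorem StrictlyProper.exists_score_le (hS : StrictlyProper S) : ∃ M, ∀ r e, S r e ≤ M := by
  classical
  refine ⟨∑ e, |S ⟨Pi.single e 1, single_mem_stdSimplex ℝ e⟩ e|, fun r e => ?_⟩
  have h := hS.le ⟨Pi.single e 1, single_mem_stdSimplex ℝ e⟩ r
  simp only [Pi.single_apply, ite_mul, one_mul, zero_mul, Finset.sum_ite_eq', Finset.mem_univ,
    if_true] at h
  refine h.trans ((le_abs_self _).trans ?_)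
  exact Finset.single_le_sum (f := fun e => |S ⟨Pi.single e 1, single_mem_stdSimplex ℝ e⟩ e|)
    (fun _ _ => abs_nonneg _) (Finset.mem_univ e)

/-- A truthful score may be very negative only on unlikely outcomes: scores are bounded above, while
the expected score under `q` is at least that of a fixed report `u`, so no single term can be very
negative. -/
theorem StrictlyProper.exists_abs_mul_score_le (hS : StrictlyProper S) :
    ∃ C, ∀ (q : Prediction E) e, |q.1 e * S q e| ≤ C := by
  classical
  obtain ⟨M, hM⟩ := hS.exists_score_le
  have hq1 : ∀ (q : Prediction E) e, q.1 e ≤ 1 := fun q e => by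
    rw [← q.2.2]
    exact Finset.single_le_sum (fun e _ => q.2.1 e) (Finset.mem_univ e)
  have hup : ∀ (q : Prediction E) r e, q.1 e * S r e ≤ |M| := fun q r e => by
    have h0 := q.2.1 e
    have h1 := hq1 q e
    calc q.1 e * S r e ≤ q.1 e * |M| :=
          mul_le_mul_of_nonneg_left ((hM r e).trans (le_abs_self M)) h0
      _ ≤ 1 * |M| := mul_le_mul_of_nonneg_right h1 (abs_nonneg _)
      _ = |M| := one_mul _
  rcases isEmpty_or_nonempty (Prediction E) with he | ⟨⟨u⟩⟩
  · exact ⟨0, fun q => he.elim q⟩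
  refine ⟨∑ e, |S u e| + ∑ _e : E, |M| + |M|, fun q e => ?_⟩
  have hsum0 : 0 ≤ ∑ _e : E, |M| := Finset.sum_nonneg fun _ _ => abs_nonneg _
  have hsum1 : 0 ≤ ∑ e, |S u e| := Finset.sum_nonneg fun _ _ => abs_nonneg _
  rw [abs_le]
  constructor
  · have h1 : -∑ e, |S u e| ≤ ∑ e, q.1 e * S u e := by
      rw [← Finset.sum_neg_distrib]
      refine Finset.sum_le_sum fun e _ => ?_
      refine neg_le_of_abs_le ?_
      rw [abs_mul, abs_of_nonneg (q.2.1 e)]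
      exact mul_le_of_le_one_left (abs_nonneg _) (hq1 q e)
    have h2 := hS.le q u
    have h3 : ∑ e' ∈ Finset.univ.erase e, q.1 e' * S q e' ≤ ∑ _e : E, |M| :=
      (Finset.sum_le_sum fun e' _ => hup q q e').trans
        (Finset.sum_le_sum_of_subset_of_nonneg (Finset.subset_univ _) fun _ _ _ => abs_nonneg _)
    have h4 := Finset.add_sum_erase Finset.univ (fun e => q.1 e * S q e) (Finset.mem_univ e)
    have := abs_nonneg M
    linarith
  · have := hup q q e
    linarith

/-- The realized score is the sum over outcomes of the score on the event of that outcome. -/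
theorem score_eq_sum_indicator (S : Prediction E → E → ℝ) (out : Ω → E) (X : Ω → Prediction E) :
    (fun ω => S (X ω) (out ω)) =
      fun ω => ∑ e, (out ⁻¹' {e}).indicator (fun ω => S (X ω) e) ω := by
  classical
  ext ω
  simp [Set.indicator_apply]

variable [IsProbabilityMeasure μ]

theorem integrable_score_indicator (hout : Measurable out) {X : Ω → Prediction E}
    (hX : Integrable (fun ω => S (X ω) (out ω)) μ) (e : E) :
    Integrable ((out ⁻¹' {e}).indicator fun ω => S (X ω) e) μ := by
  refine (hX.indicator (hout (measurableSet_singleton e))).congr (Filter.Eventually.of_forall ?_)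
  intro ω
  by_cases h : out ω = e <;> simp [h]

theorem integral_score_eq (hSm : ∀ e, Measurable fun q => S q e) (hout : Measurable out)
    {m : MeasurableSpace Ω} (hm : m ≤ mΩ) {X : Ω → Prediction E} (hXm : Measurable[m] X)
    (hX : Integrable (fun ω => S (X ω) (out ω)) μ) :
    Integrable (fun ω => ∑ e, posterior μ out m e ω * S (X ω) e) μ ∧
    ∫ ω, S (X ω) (out ω) ∂μ = ∫ ω, ∑ e, posterior μ out m e ω * S (X ω) e ∂μ := by
  have h : ∀ e, Integrable (fun ω => posterior μ out m e ω * S (X ω) e) μ ∧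
      ∫ ω, (out ⁻¹' {e}).indicator (fun ω => S (X ω) e) ω ∂μ =
        ∫ ω, posterior μ out m e ω * S (X ω) e ∂μ := fun e => integral_indicator_eq_integral_condExp_mul
    (hout (measurableSet_singleton e)) hm (f := fun ω => S (X ω) e) ((hSm e).comp hXm)
    (integrable_score_indicator hout hX e)
  refine ⟨integrable_finsetSum _ fun e _ => (h e).1, ?_⟩
  rw [score_eq_sum_indicator, integral_finsetSum _ fun e _ => integrable_score_indicator hout hX e,
    integral_finsetSum _ fun e _ => (h e).1]
  exact Finset.sum_congr rfl fun e _ => (h e).2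

theorem integrable_score_truthfulReport (hS : StrictlyProper S)
    (hSm : ∀ e, Measurable fun q => S q e) (q₀ : Prediction E) (hout : Measurable out)
    {m : MeasurableSpace Ω} (hm : m ≤ mΩ) :
    Integrable (fun ω => S (truthfulReport μ out q₀ m ω) (out ω)) μ := by
  rw [score_eq_sum_indicator]
  refine integrable_finsetSum _ fun e _ => ?_
  have hmeas := measurable_truthfulReport (μ := μ) (out := out) q₀ m
  refine integrable_indicator_of_integrable_condExp_mul (hout (measurableSet_singleton e)) hm
    ((hSm e).comp hmeas) ?_
  obtain ⟨C, hC⟩ := hS.exists_abs_mul_score_le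
  refine Integrable.of_bound ?_ C ?_
  · exact ((stronglyMeasurable_condExp.mono hm).measurable.mul
      (((hSm e).comp hmeas).mono hm le_rfl)).aestronglyMeasurable
  · filter_upwards [truthfulReport_ae_eq (μ := μ) q₀ hout hm] with ω hω
    have := hC (truthfulReport μ out q₀ m ω) e
    rw [hω e] at this
    exact this

theorem iSup_score_eq (hS : StrictlyProper S) (q : Prediction E) :
    ⨆ r : Prediction E, ∑ e, q.1 e * S r e = ∑ e, q.1 e * S q e :=
  le_antisymm (haveI : Nonempty (Prediction E) := ⟨q⟩; ciSup_le fun r => hS.le q r)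
    (le_ciSup (f := fun r : Prediction E => ∑ e, q.1 e * S r e)
      ⟨_, Set.forall_mem_range.2 fun r => hS.le q r⟩ q)

theorem integral_score_truthfulReport (hS : StrictlyProper S)
    (hSm : ∀ e, Measurable fun q => S q e) (q₀ : Prediction E) (hout : Measurable out)
    {m : MeasurableSpace Ω} (hm : m ≤ mΩ) :
    ∫ ω, S (truthfulReport μ out q₀ m ω) (out ω) ∂μ = signalValue μ out S m := by
  rw [(integral_score_eq hSm hout hm (measurable_truthfulReport q₀ m)
    (integrable_score_truthfulReport hS hSm q₀ hout hm)).2]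
  refine integral_congr_ae ?_
  filter_upwards [truthfulReport_ae_eq (μ := μ) q₀ hout hm] with ω hω
  simp only [← hω]
  exact (iSup_score_eq hS _).symm

theorem score_le_score_truthfulReport (hS : StrictlyProper S) (q₀ : Prediction E)
    (hout : Measurable out) {m : MeasurableSpace Ω} (hm : m ≤ mΩ) (X : Ω → Prediction E) :
    (fun ω => ∑ e, posterior μ out m e ω * S (X ω) e) ≤ᵐ[μ]
      fun ω => ∑ e, posterior μ out m e ω * S (truthfulReport μ out q₀ m ω) e := by
  filter_upwards [truthfulReport_ae_eq (μ := μ) q₀ hout hm] with ω hω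
  simp only [← hω]
  exact hS.le _ _

/-- No report based on `m` has a higher expected score than the value of `m`. -/
theorem integral_score_le_signalValue (hS : StrictlyProper S)
    (hSm : ∀ e, Measurable fun q => S q e) (hout : Measurable out) {m : MeasurableSpace Ω}
    (hm : m ≤ mΩ) {X : Ω → Prediction E} (hXm : Measurable[m] X)
    (hX : Integrable (fun ω => S (X ω) (out ω)) μ) :
    ∫ ω, S (X ω) (out ω) ∂μ ≤ signalValue μ out S m := by
  obtain ⟨ω₀⟩ := nonempty_of_isProbabilityMeasure μ
  have h1 := integral_score_eq hSm hout hm hXm hX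
  have h2 := integral_score_eq hSm hout hm (measurable_truthfulReport (X ω₀) m)
    (integrable_score_truthfulReport (μ := μ) hS hSm (X ω₀) hout hm)
  rw [← integral_score_truthfulReport hS hSm (X ω₀) hout hm, h1.2, h2.2]
  exact integral_mono_ae h1.1 h2.1 (score_le_score_truthfulReport hS _ hout hm X)

/-- A report based on `m` whose expected score is the value of `m` is the posterior. -/
theorem report_ae_eq_posterior (hS : StrictlyProper S)
    (hSm : ∀ e, Measurable fun q => S q e) (hout : Measurable out) {m : MeasurableSpace Ω}
    (hm : m ≤ mΩ) {X : Ω → Prediction E} (hXm : Measurable[m] X)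
    (hX : Integrable (fun ω => S (X ω) (out ω)) μ)
    (hV : signalValue μ out S m ≤ ∫ ω, S (X ω) (out ω) ∂μ) :
    ∀ᵐ ω ∂μ, ∀ e, (X ω).1 e = posterior μ out m e ω := by
  obtain ⟨ω₀⟩ := nonempty_of_isProbabilityMeasure μ
  have h1 := integral_score_eq hSm hout hm hXm hX
  have h2 := integral_score_eq hSm hout hm (measurable_truthfulReport (X ω₀) m)
    (integrable_score_truthfulReport (μ := μ) hS hSm (X ω₀) hout hm)
  have hV' := hV.antisymm' (integral_score_le_signalValue hS hSm hout hm hXm hX)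
  rw [← integral_score_truthfulReport hS hSm (X ω₀) hout hm, h1.2, h2.2,
    integral_eq_iff_of_ae_le h1.1 h2.1 (score_le_score_truthfulReport hS _ hout hm X)] at hV'
  filter_upwards [hV', truthfulReport_ae_eq (μ := μ) (X ω₀) hout hm] with ω h hω
  simp only [← hω] at h ⊢
  by_contra hne
  refine (hS (truthfulReport μ out (X ω₀) m ω) (X ω) fun heq => hne ?_).ne h
  simp [heq]

theorem signalValue_mono (hS : StrictlyProper S)
    (hSm : ∀ e, Measurable fun q => S q e) (hout : Measurable out) {m₁ m₂ : MeasurableSpace Ω}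
    (h12 : m₁ ≤ m₂) (h2 : m₂ ≤ mΩ) [Nonempty (Prediction E)] :
    signalValue μ out S m₁ ≤ signalValue μ out S m₂ := by
  obtain ⟨q₀⟩ := ‹Nonempty (Prediction E)›
  rw [← integral_score_truthfulReport hS hSm q₀ hout (h12.trans h2)]
  exact integral_score_le_signalValue hS hSm hout h2
    ((measurable_truthfulReport q₀ m₁).mono h12 le_rfl)
    (integrable_score_truthfulReport hS hSm q₀ hout (h12.trans h2))

/-- The coarser posterior is an admissible report for an observer of `m₂`; if it attains the value
of `m₂`, strict propriety makes it her posterior. -/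
theorem posterior_ae_eq_of_signalValue_le (hS : StrictlyProper S)
    (hSm : ∀ e, Measurable fun q => S q e) (hout : Measurable out) {m₁ m₂ : MeasurableSpace Ω}
    (h12 : m₁ ≤ m₂) (h2 : m₂ ≤ mΩ) [Nonempty (Prediction E)]
    (hV : signalValue μ out S m₂ ≤ signalValue μ out S m₁) :
    ∀ᵐ ω ∂μ, ∀ e, posterior μ out m₁ e ω = posterior μ out m₂ e ω := by
  obtain ⟨q₀⟩ := ‹Nonempty (Prediction E)›
  rw [← integral_score_truthfulReport hS hSm q₀ hout (h12.trans h2)] at hV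
  filter_upwards [report_ae_eq_posterior hS hSm hout h2
    ((measurable_truthfulReport q₀ m₁).mono h12 le_rfl)
    (integrable_score_truthfulReport hS hSm q₀ hout (h12.trans h2)) hV,
    truthfulReport_ae_eq (μ := μ) q₀ hout (h12.trans h2)] with ω h h' e
  rw [← h', h]

theorem condExp_ae_eq_of_reveals {m₁ m₂ : MeasurableSpace Ω} (h12 : m₁ ≤ m₂) (h2 : m₂ ≤ mΩ)
    (hr : Reveals μ m₁ m₂) {f : Ω → ℝ} (hf : Integrable f μ) : μ[f | m₁] =ᵐ[μ] μ[f | m₂] := by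
  refine ae_eq_condExp_of_forall_setIntegral_eq h2 hf (fun _ _ _ => integrable_condExp.integrableOn)
    (fun X hX _ => ?_) (stronglyMeasurable_condExp.mono h12).aestronglyMeasurable
  obtain ⟨Y, hY, hXY⟩ := hr X hX
  rw [setIntegral_congr_set hXY, setIntegral_congr_set hXY,
    setIntegral_condExp (h12.trans h2) hf hY]

/-- The sets almost everywhere equal to a set of `m₁` form a σ-algebra, so one containing `m₁` and
`m₂` contains their join. -/
theorem Reveals.sup {m₁ m₂ : MeasurableSpace Ω} (hr : Reveals μ m₁ m₂) :
    Reveals μ m₁ (m₁ ⊔ m₂) := by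
  have : m₁ ⊔ m₂ ≤ eventuallyMeasurableSpace m₁ (ae μ) :=
    sup_le le_eventuallyMeasurableSpace hr
  exact this

theorem signalValue_congr {m₁ m₂ : MeasurableSpace Ω}
    (h : ∀ e, posterior μ out m₁ e =ᵐ[μ] posterior μ out m₂ e) (S : Prediction E → E → ℝ) :
    signalValue μ out S m₁ = signalValue μ out S m₂ := by
  refine integral_congr_ae ?_
  filter_upwards [ae_all_iff.2 h] with ω hω
  simp only [hω]

theorem signalValue_le_of_reveals (hS : StrictlyProper S)
    (hSm : ∀ e, Measurable fun q => S q e) (hout : Measurable out) {m₁ m₂ : MeasurableSpace Ω}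
    (h1 : m₁ ≤ mΩ) (h2 : m₂ ≤ mΩ) [Nonempty (Prediction E)] (hr : Reveals μ m₁ m₂) :
    signalValue μ out S m₂ ≤ signalValue μ out S m₁ := by
  refine (signalValue_mono hS hSm hout le_sup_right (sup_le h1 h2)).trans_eq
    (signalValue_congr (fun e => ?_) S)
  exact (condExp_ae_eq_of_reveals le_sup_left (sup_le h1 h2) hr.sup
    ((integrable_const 1).indicator (hout (measurableSet_singleton e)))).symm

end SignalValue

/-! ### Invariance of signal values under measure-preserving maps and independent seeds. -/

section Transfer

variable {Ω Ω' E : Type*} {m : MeasurableSpace Ω} {m' : MeasurableSpace Ω'}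
  {mΩ : MeasurableSpace Ω} {mΩ' : MeasurableSpace Ω'} {μ : Measure Ω}
  {μ' : Measure Ω'}

theorem MeasureTheory.MeasurePreserving.condExp_comp [IsFiniteMeasure μ] [IsFiniteMeasure μ']
    {ψ : Ω' → Ω} (hψ : MeasurePreserving ψ μ' μ) {f : Ω → ℝ} (hf : Integrable f μ) (hm : m ≤ mΩ) :
    μ'[f ∘ ψ | m.comap ψ] =ᵐ[μ'] μ[f | m] ∘ ψ := by
  have hm' : m.comap ψ ≤ mΩ' := (MeasurableSpace.comap_mono hm).trans hψ.measurable.comap_le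
  symm
  refine ae_eq_condExp_of_forall_setIntegral_eq hm' (hψ.integrable_comp_of_integrable hf)
    (fun _ _ _ => (hψ.integrable_comp_of_integrable integrable_condExp).integrableOn) ?_ ?_
  · rintro _ ⟨s, hs, rfl⟩ -
    have h : ∀ g : Ω → ℝ, Integrable g μ →
        ∫ x in ψ ⁻¹' s, (g ∘ ψ) x ∂μ' = ∫ x in s, g x ∂μ := fun g hg => by
      rw [← hψ.map_eq] at hg ⊢
      exact (setIntegral_map (hm s hs) hg.1 hψ.measurable.aemeasurable).symm
    rw [h _ hf, h _ integrable_condExp, setIntegral_condExp hm hf hs]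
  · exact (stronglyMeasurable_condExp.comp_measurable
      (comap_measurable ψ)).aestronglyMeasurable

/-- By Fubini: for each fixed seed, the section of an event of the join is an event of `m`, where
the defining identity of `P[f | m]` applies. -/
theorem condExp_prod_fst {α β : Type*} {m mα : MeasurableSpace α} {mβ : MeasurableSpace β}
    {P : Measure α} {ν : Measure β} [IsFiniteMeasure P] [IsProbabilityMeasure ν] {f : α → ℝ}
    (hf : Integrable f P) (hm : m ≤ mα) :
    (P.prod ν)[f ∘ Prod.fst | m.comap Prod.fst ⊔ mβ.comap Prod.snd] =ᵐ[P.prod ν]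
      P[f | m] ∘ Prod.fst := by
  have hm' : m.comap Prod.fst ⊔ mβ.comap Prod.snd ≤ mα.prod mβ :=
    sup_le_sup (MeasurableSpace.comap_mono hm) le_rfl
  have hfst := measurePreserving_fst (μ := P) (ν := ν)
  symm
  refine ae_eq_condExp_of_forall_setIntegral_eq hm' (hfst.integrable_comp_of_integrable hf)
    (fun _ _ _ => (hfst.integrable_comp_of_integrable integrable_condExp).integrableOn) ?_ ?_
  · intro s hs _
    have h : ∀ g : α → ℝ, Integrable g P → ∫ x in s, (g ∘ Prod.fst) x ∂(P.prod ν) =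
        ∫ y, ∫ x in (fun x => (x, y)) ⁻¹' s, g x ∂P ∂ν := fun g hg => by
      rw [← integral_indicator (hm' s hs), integral_prod_symm _
        ((hfst.integrable_comp_of_integrable hg).indicator (hm' s hs))]
      refine integral_congr_ae (Filter.Eventually.of_forall fun y => ?_)
      have hy : MeasurableSet[mα] ((fun x => (x, y)) ⁻¹' s) :=
        measurable_prodMk_right (hm' s hs)
      simp only
      rw [← integral_indicator hy]
      rfl
    rw [h _ hf, h _ integrable_condExp]
    refine integral_congr_ae (Filter.Eventually.of_forall fun y => ?_)
    exact setIntegral_condExp hm hf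
      (@measurable_prodMk_right α β m mβ y s hs)
  · have : StronglyMeasurable[m.comap Prod.fst] (P[f | m] ∘ (Prod.fst : α × β → α)) :=
      stronglyMeasurable_condExp.comp_measurable (comap_measurable Prod.fst)
    exact ⟨_, this.mono le_sup_left, ae_eq_refl _⟩

variable [Fintype E] [MeasurableSpace E] [MeasurableSingletonClass E] {out : Ω → E}
  {S : Prediction E → E → ℝ} [IsProbabilityMeasure μ] [IsProbabilityMeasure μ']

theorem signalValue_eq_of_posterior_comp (hS : StrictlyProper S)
    (hSm : ∀ e, Measurable fun q => S q e) (hout : Measurable out)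
    {ψ : Ω' → Ω} (hψ : MeasurePreserving ψ μ' μ) (hm : m ≤ mΩ)
    (h : ∀ e, posterior μ' (out ∘ ψ) m' e =ᵐ[μ'] posterior μ out m e ∘ ψ) :
    signalValue μ' (out ∘ ψ) S m' = signalValue μ out S m := by
  obtain ⟨ω₀⟩ := nonempty_of_isProbabilityMeasure μ'
  have : Nonempty E := ⟨out (ψ ω₀)⟩
  have q₀ : Prediction E := Classical.arbitrary _
  -- A measurable version of the supremum over all predictions, needed for the change of variables.
  set v : Ω → ℝ := fun ω => ∑ e, posterior μ out m e ω * S (truthfulReport μ out q₀ m ω) e with hv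
  have hvm : Measurable[mΩ] v := Finset.measurable_fun_sum _ fun e _ =>
    (stronglyMeasurable_condExp.mono hm).measurable.mul
      (((hSm e).comp (measurable_truthfulReport q₀ m)).mono hm le_rfl)
  have hsup : (fun ω => ⨆ d : Prediction E, ∑ e, posterior μ out m e ω * S d e) =ᵐ[μ] v := by
    filter_upwards [truthfulReport_ae_eq (μ := μ) q₀ hout hm] with ω hω
    simp only [hv, ← hω]
    exact iSup_score_eq hS _
  calc signalValue μ' (out ∘ ψ) S m'
      = ∫ ω, v (ψ ω) ∂μ' := by
        refine integral_congr_ae ?_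
        filter_upwards [ae_all_iff.2 h, hψ.quasiMeasurePreserving.ae hsup] with ω h1 h2
        simp only [h1]
        exact h2
    _ = ∫ ω, v ω ∂μ := by
        rw [← hψ.map_eq]
        exact (integral_map hψ.measurable.aemeasurable hvm.aestronglyMeasurable).symm
    _ = signalValue μ out S m := (integral_congr_ae hsup).symm

theorem signalValue_comap (hS : StrictlyProper S) (hSm : ∀ e, Measurable fun q => S q e)
    (hout : Measurable out) {ψ : Ω' → Ω} (hψ : MeasurePreserving ψ μ' μ) (hm : m ≤ mΩ) :
    signalValue μ' (out ∘ ψ) S (m.comap ψ) = signalValue μ out S m :=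
  signalValue_eq_of_posterior_comp hS hSm hout hψ hm fun e =>
    hψ.condExp_comp (f := (out ⁻¹' {e}).indicator fun _ => 1)
      ((integrable_const 1).indicator (hout (measurableSet_singleton e))) hm

/-- Observing an independent seed does not change the value of a signal. -/
theorem signalValue_comap_fst_sup_comap_snd {β : Type*} {mβ : MeasurableSpace β} {ν : Measure β}
    [IsProbabilityMeasure ν] (hS : StrictlyProper S) (hSm : ∀ e, Measurable fun q => S q e)
    (hout : Measurable out) (hm : m ≤ mΩ) :
    signalValue (μ.prod ν) (fun ω => out ω.1) S (m.comap Prod.fst ⊔ mβ.comap Prod.snd) =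
      signalValue (μ.prod ν) (fun ω => out ω.1) S (m.comap Prod.fst) :=
  (signalValue_eq_of_posterior_comp (ψ := Prod.fst) hS hSm hout measurePreserving_fst hm fun e =>
    condExp_prod_fst (f := (out ⁻¹' {e}).indicator fun _ => 1)
      ((integrable_const 1).indicator (hout (measurableSet_singleton e))) hm).trans
    (signalValue_comap hS hSm hout measurePreserving_fst hm).symm

end Transfer

/-! ### Telescoping inequalities for payoffs. -/

section Accounting

variable {J : Type*} [Fintype J] [DecidableEq J] {order : ℕ → J} {N : ℕ}
  {z : ℕ → J → ℝ} {W VQ U H : ℕ → ℝ}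

theorem exists_last_trade {order : ℕ → J} {t₀ t₁ : ℕ} (h : t₀ < t₁) :
    ∃ t, t₀ ≤ t ∧ t < t₁ ∧ order t = order t₀ ∧ ∀ s, t < s → s < t₁ → order s ≠ order t₀ := by
  obtain ⟨t, ht, hmax⟩ := ((Finset.Ico t₀ t₁).filter fun t => order t = order t₀).exists_max_image id
    ⟨t₀, by simp [h]⟩
  simp only [Finset.mem_filter, Finset.mem_Ico, id] at ht hmax
  exact ⟨t, ht.1.1, ht.1.2, ht.2, fun s hs hs1 he =>
    absurd (hmax s ⟨⟨by omega, hs1⟩, he⟩) (by omega)⟩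

/-- Payoff accounting: `z t j` is the payoff of trader `j` from the steps before `t`, `W t` the
score of the prediction at `t`, `VQ t` the value of the signals of the traders who arrived before
`t`, `H t` the value of the history at `t` and `U t` its value joined with the trader's signal. -/
theorem exists_optimal_report_of_accounting
    (hz0 : ∀ j, z 0 j = 0)
    (hzs : ∀ t < N, ∀ j, z (t + 1) j = z t j + if order t = j then W (t + 1) - W t else 0)
    (hcease : ∀ t ≤ N, ∀ j, z t j ≤ z N j)
    (htruth : ∀ t < N, z t (order t) + U t - W t ≤ z N (order t))
    (hWH : ∀ t < N, W t ≤ H t)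
    (hsub : ∀ t < N, (∀ s < t, order s ≠ order t) → VQ (t + 1) - VQ t ≤ U t - H t)
    (hstrict : ∀ t < N, (∀ s < t, order s ≠ order t) → U t - H t ≤ VQ (t + 1) - VQ t → VQ t ≤ H t)
    (hVQ : ∀ t < N, (∃ s < t, order s = order t) → VQ (t + 1) = VQ t)
    (hW0 : W 0 = VQ 0) (hWN : W N ≤ VQ N)
    (hU : ∀ s t, s ≤ t → t < N → order s = order t → U s ≤ U t)
    {t₀ : ℕ} (ht₀ : t₀ < N) (hfirst : ∀ s < t₀, order s ≠ order t₀) :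
    ∃ t < N, order t = order t₀ ∧ VQ (t + 1) ≤ U t ∧ VQ (t + 1) ≤ W (t + 1) ∧
      ∀ t₁ < N, (∀ s < t₁, order s ≠ order t₁) → t₀ < t₁ → t < t₁ := by
  have hzero : ∀ t ≤ N, ∀ j, j ∉ (Finset.range t).image order → z t j = 0 := by
    intro t
    induction t with
    | zero => exact fun _ j _ => hz0 j
    | succ t ih =>
      intro ht j hj
      rw [Finset.range_add_one, Finset.image_insert, Finset.mem_insert, not_or] at hj
      rw [hzs t ht, ih (by omega) j hj.2, if_neg (Ne.symm hj.1), add_zero]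
  have hsum : ∀ t ≤ N, ∑ j, z t j = W t - W 0 := by
    intro t
    induction t with
    | zero => simp [hz0]
    | succ t ih =>
      intro ht
      rw [Finset.sum_congr rfl fun j _ => hzs t ht j, Finset.sum_add_distrib, ih (by omega)]
      simp
  have hsum' : ∀ t ≤ N, ∑ j ∈ (Finset.range t).image order, z t j = W t - W 0 := fun t ht => by
    rw [← hsum t ht]
    exact Finset.sum_subset (Finset.subset_univ _) fun j _ hj => hzero t ht j hj
  -- The slack: equilibrium payoffs of those arrived before `t` in excess of the value of their
  -- signals. It starts at 0, never decreases and ends at most 0, so it vanishes throughout.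
  set g : ℕ → ℝ := fun t => ∑ j ∈ (Finset.range t).image order, z N j - (VQ t - VQ 0) with hg
  have hnew : ∀ t < N, (∀ s < t, order s ≠ order t) → z t (order t) = 0 := fun t ht hf =>
    hzero t ht.le _ (by simpa using hf)
  have hstep : ∀ t < N, g t ≤ g (t + 1) := by
    intro t ht
    simp only [hg, Finset.range_add_one, Finset.image_insert]
    by_cases hf : ∀ s < t, order s ≠ order t
    · rw [Finset.sum_insert (by simpa using hf)]
      linarith [hsub t ht hf, htruth t ht, hWH t ht, hnew t ht hf]
    · push Not at hf
      rw [Finset.insert_eq_of_mem (by simpa using hf), hVQ t ht hf]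
  have hmono : ∀ s t, s ≤ t → t ≤ N → g s ≤ g t := by
    intro s t hst
    induction t, hst using Nat.le_induction with
    | base => exact fun _ => le_rfl
    | succ t _ ih => exact fun ht => (ih (by omega)).trans (hstep t ht)
  have hgN : g N ≤ 0 := by
    simp only [hg]
    rw [hsum' N le_rfl]
    linarith
  have hg0 : g 0 = 0 := by simp [hg]
  have hgt : ∀ t ≤ N, ∑ j ∈ (Finset.range t).image order, z N j = VQ t - VQ 0 := fun t ht => by
    have h1 := hmono 0 t (by omega) ht
    have h2 := hmono t N ht le_rfl
    simp only [hg] at h1 h2 hgN hg0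
    linarith
  have hgain : ∀ t < N, (∀ s < t, order s ≠ order t) → z N (order t) = VQ (t + 1) - VQ t := by
    intro t ht hf
    have h1 := hgt t ht.le
    have h2 := hgt (t + 1) ht
    rw [Finset.range_add_one, Finset.image_insert, Finset.sum_insert (by simpa using hf)] at h2
    linarith
  -- The arriving trader earns exactly her marginal value over `Q t`, so the substitutes inequality
  -- is tight and strictness applies; tightness of the truthful deviation passes the bound from `H`
  -- to `W`.
  have hH : ∀ t < N, (∀ s < t, order s ≠ order t) → VQ t ≤ H t ∧ VQ t ≤ W t := by
    intro t ht hf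
    have h1 := hgain t ht hf
    have h2 := htruth t ht
    have h3 := hnew t ht hf
    have h4 := hstrict t ht hf (by linarith [hWH t ht])
    exact ⟨h4, by linarith [hsub t ht hf]⟩
  have hconst : ∀ t₁ ≤ N, (∀ s, t₀ < s → s < t₁ → ∃ r < s, order r = order s) →
      ∀ s, t₀ + 1 ≤ s → s ≤ t₁ → VQ s = VQ (t₀ + 1) := by
    intro t₁ ht₁ hno s hs
    induction s, hs using Nat.le_induction with
    | base => exact fun _ => rfl
    | succ s hs ih =>
      intro hs1
      rw [hVQ s (by omega) (hno s hs hs1), ih (by omega)]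
  -- `t₁` is the next arrival after `t₀`, or the close if there is none; either way the price at
  -- `t₁` is worth all signals observed so far.
  obtain ⟨t₁, h01, h1N, hno, hW1⟩ : ∃ t₁, t₀ < t₁ ∧ t₁ ≤ N ∧
      (∀ s, t₀ < s → s < t₁ → ∃ r < s, order r = order s) ∧ VQ t₁ ≤ W t₁ := by
    by_cases hex : ∃ t₁, t₀ < t₁ ∧ t₁ < N ∧ ∀ s < t₁, order s ≠ order t₁
    · classical
      have hspec := Nat.find_spec hex
      refine ⟨Nat.find hex, hspec.1, hspec.2.1.le, fun s hs hs1 => ?_, (hH _ hspec.2.1 hspec.2.2).2⟩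
      by_contra hcon
      push Not at hcon
      exact Nat.find_min hex hs1 ⟨hs, hs1.trans hspec.2.1, hcon⟩
    · refine ⟨N, ht₀, le_rfl, fun s hs hs1 => ?_, ?_⟩
      · by_contra hcon
        push Not at hcon
        exact hex ⟨s, hs, hs1, hcon⟩
      · have h1 := hgt N le_rfl
        rw [hsum' N le_rfl] at h1
        linarith
  obtain ⟨t, h0t, ht1, hord, hlast⟩ := exists_last_trade (order := order) h01
  have htN : t < N := by omega
  -- Termwise `z t₁ ≤ z N`, but the sums over those who have arrived agree, so each term does.
  have hz1 : z t₁ (order t₀) = z N (order t₀) := by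
    have h1 := hsum' t₁ h1N
    have h2 := hgt t₁ h1N
    have hle : ∀ j ∈ (Finset.range t₁).image order, z t₁ j ≤ z N j := fun j _ => hcease t₁ h1N j
    have heq : ∑ j ∈ (Finset.range t₁).image order, z t₁ j =
        ∑ j ∈ (Finset.range t₁).image order, z N j :=
      le_antisymm (Finset.sum_le_sum hle) (by linarith)
    exact (Finset.sum_eq_sum_iff_of_le hle).1 heq _
      (Finset.mem_image_of_mem _ (Finset.mem_range.2 h01))
  have hz2 : ∀ s, t + 1 ≤ s → s ≤ t₁ → z s (order t₀) = z (t + 1) (order t₀) := by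
    intro s hs
    induction s, hs using Nat.le_induction with
    | base => exact fun _ => rfl
    | succ s hs ih =>
      intro hs1
      rw [hzs s (by omega), if_neg (hlast s hs hs1), add_zero, ih (by omega)]
  have hz3 := hz2 t₁ ht1 le_rfl
  have hz4 := hzs t htN (order t₀)
  rw [if_pos hord] at hz4
  have hVQt := hconst t₁ h1N hno (t + 1) (by omega) ht1
  have hUt := hU t₀ t h0t htN hord.symm
  have hU0 := hsub t₀ ht₀ hfirst
  have hH0 := (hH t₀ ht₀ hfirst).1
  have htr := htruth t htN
  rw [hord] at htr
  -- The trader's payoff is already final at `t + 1`, so the truthful deviation at `t` gives `U t ≤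
  -- W (t + 1)`; and `U t ≥ U t₀ ≥ VQ (t₀ + 1) = VQ (t + 1)`.
  refine ⟨t, htN, hord, by linarith, by linarith, fun t₂ ht₂ hf₂ h02 => ?_⟩
  by_contra hcon
  obtain ⟨r, hr, hr'⟩ := hno t₂ h02 (by omega)
  exact hf₂ r hr hr'

end Accounting

/-! ### Histories, one-step deviations and their payoffs. -/

section Market

variable {I : Type*} {A : I → Type*} {E : Type*} {J : Type*}
  [∀ s, MeasurableSpace (A s)] [Fintype E] {p₀ : Prediction E} {obs : J → Finset I}
  {order : ℕ → J} {σ : (j : J) → Strategy A E (obs j)}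

/-- The market form of the signal `A_O`. -/
abbrev marketSignal [MeasurableSpace E] (O : Finset I) :
    MeasurableSpace (((∀ s, A s) × E) × (J → unitInterval)) :=
  MeasurableSpace.comap (fun ω (s : O) => ω.1.1 s) inferInstance

theorem history_castSucc (t : ℕ) (ω : ((∀ s, A s) × E) × (J → unitInterval)) (i : Fin (t + 1)) :
    history p₀ order σ (t + 1) ω i.castSucc = history p₀ order σ t ω i := by
  simp [history]

theorem price_succ (t : ℕ) (ω : ((∀ s, A s) × E) × (J → unitInterval)) :
    price p₀ order σ (t + 1) ω = (σ (order t)).act t (fun s => ω.1.1 s) (ω.2 (order t))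
      (history p₀ order σ t ω) := by
  simp [price, history]

theorem measurable_snoc {Ω : Type*} {m : MeasurableSpace Ω} {t : ℕ}
    {f : Ω → Fin t → Prediction E} {g : Ω → Prediction E} (hf : Measurable f) (hg : Measurable g) :
    Measurable fun ω => (Fin.snoc (α := fun _ => Prediction E) (f ω) (g ω) :
      Fin (t + 1) → Prediction E) := by
  refine measurable_pi_lambda _ fun i => ?_
  refine Fin.lastCases ?_ (fun i => ?_) i
  · simpa using hg
  · simp only [Fin.snoc_castSucc]
    exact (measurable_pi_apply i).comp hf

theorem measurable_history_of_forall {m : MeasurableSpace (((∀ s, A s) × E) × (J → unitInterval))}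
    {T : ℕ} (hsig : ∀ t < T, Measurable[m] fun ω => fun s : obs (order t) => ω.1.1 s)
    (hseed : ∀ j, Measurable[m] fun ω => ω.2 j) :
    ∀ t ≤ T, Measurable[m] (history p₀ order σ t) := by
  intro t
  induction t with
  | zero => exact fun _ => measurable_const
  | succ t ih =>
    intro ht
    have h := ih (by omega)
    exact measurable_snoc h (((σ (order t)).measurable_act t).comp
      ((hsig t ht).prodMk ((hseed _).prodMk h)))

theorem measurable_signal (O : Finset I) [MeasurableSpace E] :
    Measurable fun (ω : ((∀ s, A s) × E) × (J → unitInterval)) (s : O) => ω.1.1 s :=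
  measurable_pi_lambda _ fun _ => (measurable_pi_apply _).comp (measurable_fst.comp measurable_fst)

theorem measurable_history [MeasurableSpace E] (t : ℕ) :
    Measurable (history p₀ order σ t) :=
  measurable_history_of_forall (fun _ _ => measurable_signal _)
    (fun j => (measurable_pi_apply j).comp measurable_snd) t le_rfl

/-- Histories record all earlier prices, so a returning trader knows at least what she knew before.
-/
theorem measurable_history_castSucc (t s : ℕ) (hs : s ≤ t) :
    Measurable[MeasurableSpace.comap (history p₀ order σ t) inferInstance]
      (history p₀ order σ s) := by
  induction t, hs using Nat.le_induction with
  | base => exact comap_measurable _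
  | succ t _ ih =>
    have h : Measurable[MeasurableSpace.comap (history p₀ order σ (t + 1)) inferInstance]
        (history p₀ order σ t) := by
      refine @measurable_pi_lambda _ _ _ (_) _ _ fun i => ?_
      have := (measurable_pi_apply (X := fun _ => Prediction E) i.castSucc).comp
        (comap_measurable (history p₀ order σ (t + 1)))
      refine Eq.mp (congrArg _ (funext fun ω => ?_)) this
      exact history_castSucc t ω i
    exact ih.mono h.comap_le le_rfl

/-- The strategy that follows `τ` before step `t`, reports `f` at step `t`, and never moves the
market prediction afterwards. -/
def deviation {O : Finset I} (τ : Strategy A E O) (t : ℕ)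
    (f : (s : ℕ) → ((i : O) → A i) → (Fin (s + 1) → Prediction E) → Prediction E)
    (hf : ∀ s, Measurable fun x : ((i : O) → A i) × (Fin (s + 1) → Prediction E) => f s x.1 x.2) :
    Strategy A E O where
  act s x u h := if s < t then τ.act s x u h else if s = t then f s x h else h (Fin.last s)
  measurable_act s := by
    by_cases h1 : s < t
    · simpa only [h1, if_true] using τ.measurable_act s
    · by_cases h2 : s = t
      · subst h2
        simp only [lt_irrefl, if_true, if_false]
        exact (hf s).comp (measurable_fst.prodMk (measurable_snd.comp measurable_snd))
      · simp only [h1, h2, if_false]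
        exact (measurable_pi_apply _).comp (measurable_snd.comp measurable_snd)

variable [DecidableEq J]

theorem history_update {j : J} {τ : Strategy A E (obs j)} {t : ℕ}
    (h : ∀ s < t, order s = j → τ.act s = (σ j).act s)
    (ω : ((∀ s, A s) × E) × (J → unitInterval)) :
    ∀ s ≤ t, history p₀ order (Function.update σ j τ) s ω = history p₀ order σ s ω := by
  intro s
  induction s with
  | zero => exact fun _ => rfl
  | succ s ih =>
    intro hs
    have hact : ((Function.update σ j τ) (order s)).act s = (σ (order s)).act s := by
      by_cases hj : order s = j
      · have := h s hs hj
        subst hj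
        rw [Function.update_self, this]
      · rw [Function.update_of_ne hj]
    simp only [history, ih (by omega), hact]

theorem payoff_succ (S : Prediction E → E → ℝ) (t : ℕ) (j : J)
    (ω : ((∀ s, A s) × E) × (J → unitInterval)) :
    payoff S p₀ order (t + 1) σ j ω = payoff S p₀ order t σ j ω +
      if order t = j then S (price p₀ order σ (t + 1) ω) ω.1.2 - S (price p₀ order σ t ω) ω.1.2
        else 0 := by
  unfold payoff
  rw [Finset.range_add_one, Finset.filter_insert]
  split_ifs with h
  · rw [Finset.sum_insert (by simp), add_comm]
  · simp

theorem payoff_deviation (S : Prediction E → E → ℝ) (j : J) {t N : ℕ} (ht : t < N)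
    (f : (s : ℕ) → ((i : obs j) → A i) → (Fin (s + 1) → Prediction E) → Prediction E)
    (hf : ∀ s, Measurable fun x : ((i : obs j) → A i) × (Fin (s + 1) → Prediction E) => f s x.1 x.2)
    (ω : ((∀ s, A s) × E) × (J → unitInterval)) :
    payoff S p₀ order N (Function.update σ j (deviation (σ j) t f hf)) j ω =
      payoff S p₀ order t σ j ω + if order t = j then
        S (f t (fun s => ω.1.1 s) (history p₀ order σ t ω)) ω.1.2 - S (price p₀ order σ t ω) ω.1.2
        else 0 := by
  set σ' := Function.update σ j (deviation (σ j) t f hf) with hσ'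
  have hact : ∀ s < t, order s = j → (deviation (σ j) t f hf).act s = (σ j).act s := by
    intro s hs _
    simp [deviation, hs]
  have hist : ∀ s ≤ t, history p₀ order σ' s ω = history p₀ order σ s ω :=
    history_update hact ω
  have hprice : ∀ s ≤ t, price p₀ order σ' s ω = price p₀ order σ s ω := fun s hs => by
    simp only [price, hist s hs]
  induction N, ht using Nat.le_induction with
  | base =>
    rw [payoff_succ]
    congr 1
    · refine Finset.sum_congr rfl fun s hs => ?_
      have hs' := Finset.mem_range.1 (Finset.mem_filter.1 hs).1
      rw [hprice s hs'.le, hprice (s + 1) hs']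
    · by_cases hj : order t = j
      · subst hj
        rw [price_succ, hprice t le_rfl, hist t le_rfl, hσ', Function.update_self]
        simp [deviation]
      · simp [hj]
  | succ N hN ih =>
    rw [payoff_succ, ih]
    have h1 : ¬ N < t := by omega
    have h2 : N ≠ t := by omega
    by_cases hj : order N = j
    · subst hj
      rw [price_succ, hσ', Function.update_self]
      simp [deviation, h1, h2, price]
    · simp [hj]

end Market

/-! ### From equilibrium conditions to truthful reports. -/

section Equilibrium

variable {I : Type*} {A : I → Type*} {E : Type*} {J : Type*}
  [∀ s, MeasurableSpace (A s)] [Fintype E] [MeasurableSpace E]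

/-- The sample space of the market: base signals, outcome and private seeds. -/
abbrev MarketSpace (A : I → Type*) (E : Type*) (J : Type*) : Type _ :=
  ((∀ s, A s) × E) × (J → unitInterval)

theorem comap_restrict_eq_iSup {X : Type*} (g : X → ∀ s, A s) (O : Finset I) :
    MeasurableSpace.comap (fun x (s : O) => g x s) inferInstance =
      ⨆ s ∈ O, MeasurableSpace.comap (fun x => g x s) inferInstance := by
  rw [iSup_subtype', show (inferInstance : MeasurableSpace (∀ s : O, A s)) = MeasurableSpace.pi
    from rfl, MeasurableSpace.pi, MeasurableSpace.comap_iSup]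
  simp only [MeasurableSpace.comap_comp]
  rfl

theorem marketSignal_eq_iSup (O : Finset I) :
    (marketSignal O : MeasurableSpace (MarketSpace A E J)) =
      ⨆ s ∈ O, MeasurableSpace.comap (fun ω : MarketSpace A E J => ω.1.1 s) inferInstance :=
  comap_restrict_eq_iSup (fun ω : MarketSpace A E J => ω.1.1) O

theorem marketSignal_empty :
    (marketSignal ∅ : MeasurableSpace (MarketSpace A E J)) = ⊥ := by
  rw [marketSignal_eq_iSup]
  simp

theorem marketSignal_mono {O O' : Finset I} (h : O ⊆ O') :
    (marketSignal O : MeasurableSpace (MarketSpace A E J)) ≤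
      marketSignal O' := by
  rw [marketSignal_eq_iSup, marketSignal_eq_iSup]
  exact biSup_mono fun _ hs => h hs

theorem marketSignal_sup [DecidableEq I] (O O' : Finset I) :
    (marketSignal O ⊔ marketSignal O' :
      MeasurableSpace (MarketSpace A E J)) = marketSignal (O ∪ O') := by
  rw [marketSignal_eq_iSup, marketSignal_eq_iSup, marketSignal_eq_iSup]
  simp only [Finset.mem_union, iSup_or, iSup_sup_eq]

theorem marketSignal_le (O : Finset I) :
    (marketSignal O : MeasurableSpace (MarketSpace A E J)) ≤ Prod.instMeasurableSpace :=
  (measurable_signal O).comap_le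

/-- The traders' private seeds. -/
abbrev seedSignal : MeasurableSpace (MarketSpace A E J) :=
  MeasurableSpace.comap Prod.snd inferInstance

theorem marketSignal_sup_seedSignal_le (O : Finset I) :
    (marketSignal O ⊔ seedSignal : MeasurableSpace (MarketSpace A E J)) ≤ Prod.instMeasurableSpace :=
  sup_le (marketSignal_le O) measurable_snd.comap_le

theorem measurable_history_marketSignal {p₀ : Prediction E} {obs : J → Finset I}
    {order : ℕ → J} {σ : (j : J) → Strategy A E (obs j)} {O : Finset I} {t : ℕ}
    (hO : ∀ s < t, obs (order s) ⊆ O) :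
    Measurable[marketSignal O ⊔ seedSignal] (history p₀ order σ t) := by
  refine measurable_history_of_forall (T := t) (fun s hs => ?_) (fun j => ?_) t le_rfl
  · exact measurable_iff_comap_le.2 ((marketSignal_mono (hO s hs)).trans le_sup_left)
  · exact ((measurable_pi_apply j).comp (comap_measurable Prod.snd)).mono le_sup_right le_rfl

variable [MeasurableSingletonClass E] [Fintype J]
  {P : Measure ((∀ s, A s) × E)} [IsProbabilityMeasure P] {S : Prediction E → E → ℝ}

instance : IsProbabilityMeasure (marketMeasure (J := J) P) := by
  unfold marketMeasure; infer_instance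

instance : IsProbabilityMeasure (seededPrior P) := by
  unfold seededPrior; infer_instance

theorem measurable_outcome :
    Measurable fun ω : MarketSpace A E J => ω.1.2 :=
  measurable_snd.comp measurable_fst

/-- The value of a signal in the market. -/
abbrev marketValue (P : Measure ((∀ s, A s) × E)) (S : Prediction E → E → ℝ)
    (m : MeasurableSpace (MarketSpace A E J)) : ℝ :=
  signalValue (marketMeasure P) (fun ω => ω.1.2) S m

theorem marketValue_sup_seedSignal (hS : StrictlyProper S)
    (hSm : ∀ e, Measurable fun q => S q e) (O : Finset I) :
    marketValue (J := J) P S (marketSignal O ⊔ seedSignal) =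
      marketValue (J := J) P S (marketSignal O) := by
  have h : (marketSignal O : MeasurableSpace (MarketSpace A E J)) =
      (MeasurableSpace.comap (fun (x : (∀ s, A s) × E) (s : O) => x.1 s) inferInstance).comap
        Prod.fst := by
    rw [MeasurableSpace.comap_comp]; rfl
  rw [h]
  refine signalValue_comap_fst_sup_comap_snd (out := Prod.snd) hS hSm measurable_snd
    (Measurable.comap_le ?_)
  exact measurable_pi_lambda _ fun _ => (measurable_pi_apply _).comp measurable_fst

/-- A single uniform seed can simulate all private seeds. Only a map in this direction is needed,
because signals are pulled back along it. -/
theorem exists_measurePreserving_seeded (P : Measure ((∀ s, A s) × E)) [IsProbabilityMeasure P] :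
    ∃ φ : unitInterval → (J → unitInterval), Measurable φ ∧
      Measurable (Prod.map id φ : ((∀ s, A s) × E) × unitInterval → MarketSpace A E J) ∧
      MeasurePreserving (Prod.map id φ) (seededPrior P) (marketMeasure P) := by
  obtain ⟨φ, hφ, hmap⟩ := Measure.exists_measurable_map_eq
    (Measure.pi fun _ : J => (volume : Measure unitInterval))
  exact ⟨φ, hφ, measurable_id.prodMap hφ, (MeasurePreserving.id P).prod ⟨hφ, hmap⟩⟩

theorem comap_le_of_measurable {X Y : Type*} {mX : MeasurableSpace X} {mY : MeasurableSpace Y}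
    {ψ : X → Y} (hψ : Measurable ψ) (n : MeasurableSpace Y) (hn : n ≤ mY) : n.comap ψ ≤ mX :=
  (MeasurableSpace.comap_mono hn).trans hψ.comap_le

theorem nonempty_prediction {A : I → Type*} [∀ s, MeasurableSpace (A s)]
    (P : Measure ((∀ s, A s) × E)) [IsProbabilityMeasure P] :
    Nonempty (Prediction E) := ⟨priorPrediction P⟩

/-- The substitutes condition for signals of the market that are functions of the base signals in
`O` and of the traders' seeds. -/
theorem StrictStrongSubstitutes.market [DecidableEq I] (hsubs : StrictStrongSubstitutes P S)
    (hS : StrictlyProper S) (hSm : ∀ e, Measurable fun q => S q e) (O T : Finset I)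
    {m : MeasurableSpace (MarketSpace A E J)} (hm : m ≤ marketSignal O ⊔ seedSignal) :
    marketValue (J := J) P S (marketSignal (O ∪ T)) - marketValue (J := J) P S (marketSignal O) ≤
        marketValue (J := J) P S (m ⊔ marketSignal T) - marketValue (J := J) P S m ∧
      (¬ T ⊆ O → marketValue (J := J) P S (m ⊔ marketSignal T) - marketValue (J := J) P S m ≤
          marketValue (J := J) P S (marketSignal (O ∪ T)) -
            marketValue (J := J) P S (marketSignal O) →
        marketValue (J := J) P S (marketSignal O) ≤ marketValue (J := J) P S m) := by
  obtain ⟨φ, hφ, hψm, hψ⟩ := exists_measurePreserving_seeded (J := J) P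
  have hψout := (measurable_outcome (A := A) (E := E) (J := J)).comp hψm
  have hψle := comap_le_of_measurable hψm
  have := nonempty_prediction P
  have hmΩ := hm.trans (marketSignal_sup_seedSignal_le O)
  have hval : ∀ n : MeasurableSpace (MarketSpace A E J), n ≤ Prod.instMeasurableSpace →
      signalValue (seededPrior P) (fun ω => ω.1.2) S (n.comap (Prod.map id φ)) =
        marketValue (J := J) P S n := fun n hn => signalValue_comap hS hSm measurable_outcome hψ hn
  have hsig : ∀ Q : Finset I, (subsetSignal Q : MeasurableSpace (((∀ s, A s) × E) × unitInterval)) =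
      (marketSignal Q).comap (Prod.map id φ) := fun Q => by
    rw [MeasurableSpace.comap_comp]; rfl
  have hm' : m.comap (Prod.map id φ) ≤ seededSubsetSignal O := by
    refine (MeasurableSpace.comap_mono hm).trans ?_
    rw [MeasurableSpace.comap_sup, ← hsig]
    refine sup_le ?_ ?_
    · exact Measurable.comap_le (measurable_fst.comp (comap_measurable
        fun ω : ((∀ s, A s) × E) × unitInterval => ((fun s : O => ω.1.1 s), ω.2)))
    · rw [MeasurableSpace.comap_comp]
      have h : Measurable[seededSubsetSignal O]
          (Prod.snd : ((∀ s, A s) × E) × unitInterval → unitInterval) :=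
        (comap_measurable
          fun ω : ((∀ s, A s) × E) × unitInterval => ((fun s : O => ω.1.1 s), ω.2)).snd
      exact (hφ.comp h).comap_le
  obtain ⟨h1, h2⟩ := hsubs O T (m.comap (Prod.map id φ)) hm'
  rw [hsig O, hsig T, ← MeasurableSpace.comap_sup, ← MeasurableSpace.comap_sup,
    hval (marketSignal O) (marketSignal_le O), hval m hmΩ,
    hval (m ⊔ marketSignal T) (sup_le hmΩ (marketSignal_le T)),
    hval (marketSignal O ⊔ marketSignal T) (sup_le (marketSignal_le O) (marketSignal_le T)),
    marketSignal_sup] at h1 h2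
  refine ⟨h1, fun hTO hle => ?_⟩
  -- Strictness is assumed only for incomparable sets. If `O ⊆ T`, the claim follows from
  -- monotonicity, since `O ∪ T = T`.
  by_cases hOT : O ⊆ T
  · have h3 : marketValue (J := J) P S (marketSignal T) ≤
        marketValue (J := J) P S (m ⊔ marketSignal T) :=
      signalValue_mono hS hSm measurable_outcome le_sup_right (sup_le hmΩ (marketSignal_le T))
    rw [Finset.union_eq_right.2 hOT] at hle
    linarith
  · have hr : Reveals (seededPrior P) (m.comap (Prod.map id φ))
        ((marketSignal O).comap (Prod.map id φ)) := by
      by_contra hr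
      exact (h2 hOT hTO hr).not_ge hle
    have h3 := signalValue_le_of_reveals hS hSm hψout (hψle m hmΩ) (hψle _ (marketSignal_le O)) hr
    rw [← hval _ (marketSignal_le O), ← hval _ hmΩ]
    exact h3

/-- The information at step `t` of a trader who observes the base signals in `O`. -/
abbrev signalHistory (p₀ : Prediction E) {obs : J → Finset I} (order : ℕ → J)
    (σ : (j : J) → Strategy A E (obs j)) (O : Finset I) (t : ℕ) :
    MeasurableSpace (MarketSpace A E J) :=
  MeasurableSpace.comap (fun ω => ((fun (s : O) => ω.1.1 s), history p₀ order σ t ω)) inferInstance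

variable {p₀ : Prediction E} {obs : J → Finset I} {order : ℕ → J}
  {σ : (j : J) → Strategy A E (obs j)}

theorem signalHistory_eq (O : Finset I) (t : ℕ) :
    signalHistory p₀ order σ O t =
      MeasurableSpace.comap (history p₀ order σ t) inferInstance ⊔ marketSignal O := by
  rw [sup_comm]
  exact MeasurableSpace.comap_prodMk _ _

theorem signalHistory_le (O : Finset I) (t : ℕ) :
    signalHistory p₀ order σ O t ≤ Prod.instMeasurableSpace :=
  ((measurable_signal O).prodMk (measurable_history t)).comap_le

variable [DecidableEq J] {N : ℕ}

theorem integrable_payoff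
    (hint : ∀ t ≤ N, Integrable (fun ω => S (price p₀ order σ t ω) ω.1.2) (marketMeasure P))
    (j : J) {t : ℕ} (ht : t ≤ N) : Integrable (payoff S p₀ order t σ j) (marketMeasure P) := by
  refine integrable_finsetSum _ fun s hs => ?_
  have := Finset.mem_range.1 (Finset.mem_filter.1 hs).1
  exact (hint (s + 1) (by omega)).sub (hint s (by omega))

theorem integral_payoff_succ
    (hint : ∀ t ≤ N, Integrable (fun ω => S (price p₀ order σ t ω) ω.1.2) (marketMeasure P))
    (j : J) {t : ℕ} (ht : t < N) :
    ∫ ω, payoff S p₀ order (t + 1) σ j ω ∂(marketMeasure P) =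
      ∫ ω, payoff S p₀ order t σ j ω ∂(marketMeasure P) + if order t = j then
        ∫ ω, S (price p₀ order σ (t + 1) ω) ω.1.2 ∂(marketMeasure P) -
          ∫ ω, S (price p₀ order σ t ω) ω.1.2 ∂(marketMeasure P) else 0 := by
  simp only [payoff_succ]
  split_ifs with h
  · have hsub := (hint (t + 1) ht).sub (hint t ht.le)
    rw [← integral_sub (hint (t + 1) ht) (hint t ht.le)]
    exact integral_add (integrable_payoff hint j ht.le) hsub
  · simp

/-- In equilibrium a trader cannot gain by ceasing to trade at step `t`. -/
theorem IsBayesNash.integral_payoff_le (hσ : IsBayesNash P S order N σ) (j : J) {t : ℕ}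
    (ht : t ≤ N) :
    ∫ ω, payoff S (priorPrediction P) order t σ j ω ∂(marketMeasure P) ≤
      ∫ ω, payoff S (priorPrediction P) order N σ j ω ∂(marketMeasure P) := by
  rcases ht.eq_or_lt with rfl | ht
  · exact le_rfl
  have hf : ∀ s, Measurable fun x : ((i : obs j) → A i) × (Fin (s + 1) → Prediction E) =>
      x.2 (Fin.last s) := fun s => (measurable_pi_apply _).comp measurable_snd
  have hdev : payoff S (priorPrediction P) order N
      (Function.update σ j (deviation (σ j) t (fun s _ h => h (Fin.last s)) hf)) j =
        payoff S (priorPrediction P) order t σ j := by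
    ext ω
    rw [payoff_deviation S j ht]
    simp [price]
  have h := hσ.2 j (deviation (σ j) t (fun s _ h => h (Fin.last s)) hf)
  rw [hdev] at h
  exact h (integrable_payoff hσ.1 j ht.le)

/-- In equilibrium a trader cannot gain by reporting truthfully at step `t` and then ceasing to
trade. -/
theorem IsBayesNash.integral_payoff_add_le (hσ : IsBayesNash P S order N σ)
    (hS : StrictlyProper S) (hSm : ∀ e, Measurable fun q => S q e) {t : ℕ} (ht : t < N) :
    ∫ ω, payoff S (priorPrediction P) order t σ (order t) ω ∂(marketMeasure P) +
        marketValue (J := J) P S (signalHistory (priorPrediction P) order σ (obs (order t)) t) -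
        ∫ ω, S (price (priorPrediction P) order σ t ω) ω.1.2 ∂(marketMeasure P) ≤
      ∫ ω, payoff S (priorPrediction P) order N σ (order t) ω ∂(marketMeasure P) := by
  have := nonempty_prediction P
  set j := order t with hj
  set p₀ := priorPrediction P
  set r := fun s => truthfulReport (marketMeasure P) (fun ω => ω.1.2) p₀
    (signalHistory p₀ order σ (obs j) s) with hr
  -- The posterior factors measurably through signal and history, so reporting it is a legitimate
  -- strategy.
  choose f hf hfr using fun s =>
    (measurable_truthfulReport (μ := marketMeasure P) (out := fun ω => ω.1.2) p₀
      (signalHistory p₀ order σ (obs j) s)).exists_eq_measurable_comp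
  have hint := integrable_score_truthfulReport (μ := marketMeasure (J := J) P) hS hSm p₀
    measurable_outcome (signalHistory_le (p₀ := p₀) (order := order) (σ := σ) (obs j) t)
  have hdev : payoff S p₀ order N
      (Function.update σ j (deviation (σ j) t (fun s x h => f s (x, h)) hf)) j =
        fun ω => payoff S p₀ order t σ j ω + (S (r t ω) ω.1.2 - S (price p₀ order σ t ω) ω.1.2) := by
    ext ω
    rw [payoff_deviation S j ht, if_pos hj.symm]
    simp only [hr, hfr t]
    rfl
  have h := hσ.2 j (deviation (σ j) t (fun s x h => f s (x, h)) hf)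
  rw [hdev] at h
  have hpay := integrable_payoff hσ.1 j ht.le
  have hsub := hint.sub (hσ.1 t ht.le)
  have h := h (hpay.add hsub)
  have hadd := integral_add hpay hsub
  simp only [Pi.sub_apply] at hadd
  rw [hadd, integral_sub hint (hσ.1 t ht.le),
    integral_score_truthfulReport hS hSm p₀ measurable_outcome (signalHistory_le _ _)] at h
  linarith

/-- The initial price is the posterior given the trivial signal, which anchors the telescoping sum.
-/
theorem integral_score_priorPrediction (hS : StrictlyProper S)
    (hSm : ∀ e, Measurable fun q => S q e) :
    ∫ ω, S (priorPrediction P) ω.1.2 ∂(marketMeasure (J := J) P) =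
      marketValue (J := J) P S (marketSignal ∅) := by
  rw [marketSignal_empty, marketValue, ← integral_score_truthfulReport hS hSm (priorPrediction P)
    measurable_outcome bot_le]
  refine integral_congr_ae ?_
  filter_upwards [truthfulReport_ae_eq (μ := marketMeasure (J := J) P) (priorPrediction P)
    measurable_outcome bot_le] with ω hω
  congr 1
  refine Subtype.ext (funext fun e => ?_)
  rw [hω e, posterior, condExp_bot,
    integral_indicator_const _ (measurable_outcome (measurableSet_singleton e))]
  simp only [priorPrediction, marketMeasure, smul_eq_mul, mul_one]
  have := (measurePreserving_fst (μ := P) (ν := Measure.pi fun _ : J =>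
    (volume : Measure unitInterval))).measureReal_preimage
    (measurable_snd (measurableSet_singleton e)).nullMeasurableSet
  rw [← this]
  rfl

theorem IsBayesNash.allRush [DecidableEq I] (hσ : IsBayesNash P S order N σ)
    (hS : StrictlyProper S) (hSm : ∀ e, Measurable fun q => S q e)
    (hsubs : StrictStrongSubstitutes P S) (hobs : ArrivalsInformative obs order N) :
    AllRush P order N σ := by
  have := nonempty_prediction P
  rintro j t₀ ⟨ht₀, rfl, hfirst⟩
  set p₀ := priorPrediction P
  set Q : ℕ → Finset I := fun t => (Finset.range t).biUnion fun s => obs (order s) with hQ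
  have hQsub : ∀ s t, s < t → obs (order s) ⊆ Q t := fun s t hst =>
    Finset.subset_biUnion_of_mem (fun s => obs (order s)) (Finset.mem_range.2 hst)
  have hQ0 : Q 0 = ∅ := rfl
  have hQsucc : ∀ t, Q (t + 1) = Q t ∪ obs (order t) := fun t => by
    simp only [hQ, Finset.range_add_one, Finset.biUnion_insert, Finset.union_comm]
  set G : ℕ → MeasurableSpace (MarketSpace A E J) := fun t =>
    marketSignal (Q t) ⊔ seedSignal with hG
  have hGle : ∀ t, G t ≤ Prod.instMeasurableSpace := fun t => marketSignal_sup_seedSignal_le _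
  have hhist : ∀ t, MeasurableSpace.comap (history p₀ order σ t) inferInstance ≤ G t := fun t =>
    (measurable_history_marketSignal fun s hs => hQsub s t hs).comap_le
  have hprice : ∀ t, Measurable[G t] (price p₀ order σ t) := fun t =>
    ((measurable_pi_apply _).comp (comap_measurable (history p₀ order σ t))).mono (hhist t) le_rfl
  have hhistle : ∀ t, MeasurableSpace.comap (history p₀ order σ t) inferInstance ≤
      Prod.instMeasurableSpace :=
    fun t => (measurable_history t).comap_le
  have hinfo : ∀ t, signalHistory p₀ order σ (obs (order t)) t ≤ G (t + 1) := fun t => by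
    rw [signalHistory_eq]
    refine sup_le ((hhist t).trans (sup_le_sup_right (marketSignal_mono ?_) _))
      ((marketSignal_mono (hQsub t (t + 1) t.lt_succ_self)).trans le_sup_left)
    rw [hQsucc]
    exact Finset.subset_union_left
  have hV : ∀ t, marketValue (J := J) P S (G t) =
      marketValue (J := J) P S (marketSignal (Q t)) := fun t =>
    marketValue_sup_seedSignal hS hSm (Q t)
  have hsub := fun t => hsubs.market (J := J) hS hSm (Q t) (obs (order t)) (hhist t)
  simp only [← hQsucc, ← signalHistory_eq] at hsub
  obtain ⟨t, htN, hord, hU, hW, hlt⟩ := exists_optimal_report_of_accounting (order := order)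
    (N := N)
    (z := fun t j => ∫ ω, payoff S p₀ order t σ j ω ∂(marketMeasure P))
    (W := fun t => ∫ ω, S (price p₀ order σ t ω) ω.1.2 ∂(marketMeasure P))
    (VQ := fun t => marketValue (J := J) P S (marketSignal (Q t)))
    (U := fun t => marketValue (J := J) P S (signalHistory p₀ order σ (obs (order t)) t))
    (H := fun t => marketValue (J := J) P S (MeasurableSpace.comap
      (history p₀ order σ t) inferInstance))
    (fun j => by simp [payoff])
    (fun t ht j => integral_payoff_succ hσ.1 j ht)
    (fun t ht j => hσ.integral_payoff_le j ht)
    (fun t ht => hσ.integral_payoff_add_le hS hSm ht)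
    (fun t ht => integral_score_le_signalValue hS hSm measurable_outcome (hhistle t)
      ((measurable_pi_apply _).comp (comap_measurable _)) (hσ.1 t ht.le))
    (fun t _ _ => (hsub t).1)
    (fun t ht hf hle => by
      rcases t.eq_zero_or_pos with rfl | hpos
      -- The first arrival needs no new base signal: nothing has been observed before her, and the
      -- trivial signal has the least value.
      · exact signalValue_mono hS hSm measurable_outcome
          (by rw [hQ0, marketSignal_empty]; exact bot_le) (hhistle 0)
      · refine (hsub t).2 (fun hcon => ?_) hle
        obtain ⟨i, hi, hi'⟩ := hobs (order t) t ⟨ht, rfl, hf⟩ hpos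
        obtain ⟨s, hs, his⟩ := Finset.mem_biUnion.1 (hcon hi)
        exact hi' s (Finset.mem_range.1 hs) his)
    (fun t _ ⟨s, hs, hst⟩ => by
      rw [hQsucc, Finset.union_eq_left.2 (hst ▸ hQsub s t hs)])
    (integral_score_priorPrediction hS hSm)
    (by
      rw [← hV N]
      exact integral_score_le_signalValue hS hSm measurable_outcome (hGle N) (hprice N)
        (hσ.1 N le_rfl))
    (fun s t hst _ ho => by
      refine signalValue_mono hS hSm measurable_outcome ?_ (signalHistory_le _ _)
      rw [signalHistory_eq, signalHistory_eq, ho]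
      exact sup_le_sup_right (measurable_history_castSucc t s hst).comap_le _)
    ht₀ hfirst
  refine ⟨t, htN, hord, fun e => ?_, fun k t₁ hk h01 => hlt t₁ hk.1
    (fun s hs => by rw [hk.2.1]; exact hk.2.2 s hs) h01⟩
  -- Prices also depend on the seeds, so the comparison is made in `G (t + 1)`, whose value is
  -- unchanged by including them. Report and trader's posterior both equal the posterior given `G (t
  -- + 1)`.
  rw [← hV] at hU hW
  filter_upwards [posterior_ae_eq_of_signalValue_le hS hSm measurable_outcome (hinfo t)
    (hGle (t + 1)) hU, report_ae_eq_posterior hS hSm measurable_outcome (hGle (t + 1))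
    (hprice (t + 1)) (hσ.1 (t + 1) htN) hW] with ω h1 h2
  rw [h2 e]
  exact (h1 e).symm

end Equilibrium

end

theorem mainTheorem1 {I : Type*} [Fintype I] {A : I → Type*} [∀ s, Fintype (A s)]
    [∀ s, MeasurableSpace (A s)] [∀ s, MeasurableSingletonClass (A s)]
    {E : Type*} [Fintype E] [MeasurableSpace E] [MeasurableSingletonClass E]
    {J : Type*} [Fintype J] [DecidableEq J]
    (P : Measure ((∀ s, A s) × E)) [IsProbabilityMeasure P]
    (S : Prediction E → E → ℝ) (hS : StrictlyProper S) (hSm : ∀ e, Measurable fun q => S q e)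
    (hsubs : StrictStrongSubstitutes P S)
    (obs : J → Finset I) (order : ℕ → J) (N : ℕ) (hobs : ArrivalsInformative obs order N)
    (σ : (j : J) → Strategy A E (obs j)) (hσ : IsBayesNash P S order N σ) :
    AllRush P order N σ := by
  classical
  exact hσ.allRush hS hSm hsubs hobs
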